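/- **Theorem.** Let $K$ be a number field with ring of integers $\mathcal{O}_K$, and for a non-zero ideal $\mathfrak{a}$ put $N(\mathfrak{a})=|\mathcal{O}_K/\mathfrak{a}|$. Let $(\mathfrak{b}_\ell)_{\ell\ge 1}$ be an infinite sequence of pairwise coprime non-zero ideals of $\mathcal{O}_K$ with $\sum_{\ell}1/N(\mathfrak{b}_\ell)<\infty$. Let $\mathcal{O}_K$ act on $\{0,1\}^{\mathcal{O}_K}$ (product topology) by the shifts $(S_ax)_b=x_{b+a}$, and write $\operatorname{supp}x=\{a: x_a\neq 0\}$. Put $$X_{\mathfrak{B}}=\{x\in\{0,1\}^{\mathcal{O}_K} : |\operatorname{supp}x \bmod \mathfrak{b}_\ell|<N(\mathfrak{b}_\ell)\text{ for all }\ell\ge 1\}.$$ Let $s=(s_\ell)_{\ell\ge1}$ be a sequence of integers with $1\le s_\ell\le N(\mathfrak{b}_\ell)$ for all $\ell$. Then $$Y_{\ge s}=\{x\in X_{\mathfrak{B}} : |\operatorname{supp}x \bmod \mathfrak{b}_\ell|\le N(\mathfrak{b}_\ell)-s_\ell\text{ for all }\ell\ge 1\}$$ is a closed shift-invariant set, and,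 the infinite product being convergent, $$h_{top}\big((S_a)_{a\in\mathcal{O}_K},Y_{\ge s}\big)=\prod_{\ell\ge1}\Big(1-\frac{s_\ell}{N(\mathfrak{b}_\ell)}\Big).$$ Here the topological entropy, with logarithms to base $2$, may be computed along any Følner sequence $(F_n)$ in $\mathcal{O}_K$, that is, any sequence of finite sets with $|(g+F_n)\cap F_n|/|F_n|\to1$ for every $g\in\mathcal{O}_K$: $h_{top}$ is the supremum over all open covers $\mathcal{U}$ of $Y_{\ge s}$ of $\limsup_{n\to\infty}\frac{1}{|F_n|}\log_2\mathcal{N}\big(\bigvee_{a\in F_n}S_a^{-1}\mathcal{U}\big)$, where $\mathcal{N}(\mathcal{V})$ is the minimal cardinality of a subcover of $\mathcal{V}$, and the stated formula holds for each such sequence $(F_n)$. -/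

import Mathlib

open Filter Topology NumberField

noncomputable section

namespace BFree

/-! ### Topological entropy of a group action, by open covers along a Følner sequence -/

section Entropy

variable {G : Type*} [AddGroup G]

open Classical in
/-- `F` is a Følner sequence: `|(g + F n) ∩ F n| / |F n| → 1` for every `g`
(so that `F n` is nonempty for all large `n`). -/
def IsFolnerSeq (F : ℕ → Finset G) : Prop :=
  ∀ g : G, Tendsto
    (fun n => ((((F n).image (fun x => g + x)) ∩ F n).card : ℝ) / ((F n).card : ℝ))
    atTop (𝓝 1)

variable {X : Type*} [AddAction G X]

/-- The join `⋁_{a ∈ F} T_a⁻¹ U`: its members are the sets `⋂_{a ∈ F} T_a⁻¹ (φ a)`,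
where `φ a ∈ U` for `a ∈ F`. -/
def coverJoin (F : Finset G) (U : Set (Set X)) : Set (Set X) :=
  {V | ∃ φ : G → Set X, (∀ a ∈ F, φ a ∈ U) ∧ V = {x | ∀ a ∈ F, a +ᵥ x ∈ φ a}}

/-- The minimal cardinality of a finite subfamily of `U` that covers `X`
(it exists for every open cover of a compact space). -/
def minSubcover {X : Type*} (U : Set (Set X)) : ℕ :=
  sInf {n | ∃ V : Finset (Set X), (V : Set (Set X)) ⊆ U ∧
    ⋃₀ (V : Set (Set X)) = Set.univ ∧ V.card = n}

/-- The entropy of the cover `U`, with logarithms to base `2`. -/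
def coverEntropy (F : ℕ → Finset G) (U : Set (Set X)) : EReal :=
  limsup (fun n =>
    ((Real.logb 2 (minSubcover (coverJoin (F n) U)) / ((F n).card : ℝ) : ℝ) : EReal)) atTop

/-- The topological entropy of the action of `G` on the compact space `X`, computed along
the Følner sequence `F`: the supremum of the entropies of the open covers of `X`. -/
def topEntropy (F : ℕ → Finset G) (X : Type*) [TopologicalSpace X] [AddAction G X] : EReal :=
  ⨆ (U : Set (Set X)) (_ : ∀ u ∈ U, IsOpen u) (_ : ⋃₀ U = Set.univ), coverEntropy F U

end Entropy

/-! ### The full shift `{0,1}^G` -/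

/-- The space `{0,1}^G`. -/
def FullShift (G : Type*) : Type _ := G → Fin 2

instance (G : Type*) : TopologicalSpace (FullShift G) :=
  inferInstanceAs (TopologicalSpace (G → Fin 2))

/-- The shift action `(S_a x)_b = x_{b + a}`. -/
instance (G : Type*) [AddGroup G] : AddAction G (FullShift G) where
  vadd a x := fun b => x (b + a)
  zero_vadd x := funext fun b => congrArg x (add_zero b)
  add_vadd a c x := funext fun b => congrArg x (add_assoc b a c).symm

/-- The support of a point of the full shift. -/
def supp {G : Type*} (x : FullShift G) : Set G := {a | x a ≠ 0}

/-! ### Admissible points -/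

/-- `D(𝔞 | A)`: the number of residue classes modulo `𝔞` that meet `A`. -/
def resCount {R : Type*} [CommRing R] (𝔞 : Ideal R) (A : Set R) : ℕ :=
  (Ideal.Quotient.mk 𝔞 '' A).ncard

theorem resCount_vadd {R : Type*} [CommRing R] (𝔞 : Ideal R) (a : R) (x : FullShift R) :
    resCount 𝔞 (supp (a +ᵥ x)) = resCount 𝔞 (supp x) := by
  have h : Ideal.Quotient.mk 𝔞 '' supp x =
      (fun q => q + Ideal.Quotient.mk 𝔞 a) '' (Ideal.Quotient.mk 𝔞 '' supp (a +ᵥ x)) := by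
    ext q
    constructor
    · rintro ⟨c, hc, rfl⟩
      refine ⟨_, ⟨c - a, ?_, rfl⟩, by simp⟩
      change x (c - a + a) ≠ 0
      rw [sub_add_cancel]
      exact hc
    · rintro ⟨_, ⟨c, hc, rfl⟩, rfl⟩
      exact ⟨c + a, hc, map_add _ _ _⟩
  unfold resCount
  rw [h, Set.ncard_image_of_injective _ (add_left_injective _)]

variable {K : Type*} [Field K] [NumberField K]

/-- The subshift `X_𝔅` of admissible points: `D(𝔟_ℓ | supp x) < N(𝔟_ℓ)` for all `ℓ`. -/
def admissibleShift (𝔟 : ℕ → Ideal (𝓞 K)) : SubAddAction (𝓞 K) (FullShift (𝓞 K)) where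
  carrier := {x | ∀ ℓ, resCount (𝔟 ℓ) (supp x) < Ideal.absNorm (𝔟 ℓ)}
  vadd_mem' a x hx ℓ := by
    rw [resCount_vadd]
    exact hx ℓ

/-- The invariant set `Y_{≥ s} = {x ∈ X_𝔅 : D(𝔟_ℓ | supp x) ≤ N(𝔟_ℓ) - s_ℓ for all ℓ}`. -/
def YGe (𝔟 : ℕ → Ideal (𝓞 K)) (s : ℕ → ℕ) : SubAddAction (𝓞 K) (FullShift (𝓞 K)) where
  carrier := {x | x ∈ admissibleShift 𝔟 ∧
    ∀ ℓ, (resCount (𝔟 ℓ) (supp x) : ℤ) ≤ (Ideal.absNorm (𝔟 ℓ) : ℤ) - (s ℓ : ℤ)}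
  vadd_mem' a x hx := ⟨(admissibleShift 𝔟).vadd_mem a hx.1, fun ℓ => by
    rw [resCount_vadd]
    exact hx.2 ℓ⟩

end BFree

end

/-! Upper bound: by the Chinese remainder theorem the first n ideals give a surjection from the ring
onto a finite group Q, the product of the quotients. The support of a point of Y lies over at most m
= ∏ (N(𝔟_ℓ) - s_ℓ) classes of Q. Følner sets are equidistributed over these classes, so up to o(|F|)
the points of Y show at most 2^|Q| · 2^(|F| m/|Q|) patterns on F. A given open cover only sees
coordinates in W + F for a fixed finite W, which is F up to o(|F|). Its entropy is therefore at most
m/|Q|, the n-th partial product (`coverEntropy_le`).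

Lower bound: from any finite F delete, for each ℓ in turn, s_ℓ classes mod 𝔟_ℓ containing at most
the average share of what remains. The sets decrease and are finite, so they stabilise at some B
with |B| ≥ |F| ∏ (1 - s_ℓ/N(𝔟_ℓ)) that misses s_ℓ classes for every ℓ
(`exists_subset_avoiding_classes`). All 2^|B| configurations supported in B lie in Y, and the
partition by the coordinate at 0 separates them (`le_topEntropy`). -/

namespace BFree

/-! ### Følner sequences: growth, equidistribution, boundaries -/

section FolnerSets

variable {G : Type*} [AddCommGroup G]

open Classical in
theorem IsFolnerSeq.tendsto_card_image_sdiff {F : ℕ → Finset G} (hF : IsFolnerSeq F) (g : G) :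
    Tendsto (fun n => ((((F n).image (fun x => g + x)) \ F n).card : ℝ) / ((F n).card : ℝ))
      atTop (𝓝 0) := by
  have h := hF g
  have h2 : Tendsto (fun n => 1 - ((((F n).image (fun x => g + x)) ∩ F n).card : ℝ) /
      ((F n).card : ℝ)) atTop (𝓝 0) := by simpa using h.const_sub 1
  refine h2.congr' ?_
  filter_upwards [h.eventually_ne (one_ne_zero)] with n hn
  have h0 : ((F n).card : ℝ) ≠ 0 := fun h0 => hn (by rw [h0, div_zero])
  have h1 := Finset.card_sdiff_add_card_inter ((F n).image (fun x => g + x)) (F n)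
  rw [Finset.card_image_of_injective _ (add_right_injective g)] at h1
  have h3 : ((((F n).image (fun x => g + x)) \ F n).card : ℝ) +
      ((((F n).image (fun x => g + x)) ∩ F n).card : ℝ) = (F n).card := by exact_mod_cast h1
  field_simp
  linarith

theorem IsFolnerSeq.eventually_nonempty {F : ℕ → Finset G} (hF : IsFolnerSeq F) :
    ∀ᶠ n in atTop, (F n).Nonempty := by
  filter_upwards [(hF 0).eventually_ne one_ne_zero] with n hn
  by_contra h
  rw [Finset.not_nonempty_iff_eq_empty] at h
  simp [h] at hn

-- If |F n| < k, an invariance defect below 1/(k+1) is an integer count below 1, hence zero. So k +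
-- 1 distinct translates of one point of F n would lie in F n.
open Classical in
theorem IsFolnerSeq.tendsto_card [Infinite G] {F : ℕ → Finset G} (hF : IsFolnerSeq F) :
    Tendsto (fun n => ((F n).card : ℝ)) atTop atTop := by
  refine tendsto_natCast_atTop_atTop.comp (tendsto_atTop.2 fun k => ?_)
  obtain ⟨S, hS⟩ := Infinite.exists_subset_card_eq G (k + 1)
  have hk : (0 : ℝ) < 1 / (k + 1) := by positivity
  have h1 : ∀ᶠ n in atTop, ∀ g ∈ S,
      ((((F n).image (fun x => g + x)) \ F n).card : ℝ) / ((F n).card : ℝ) < 1 / (k + 1) :=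
    (Finset.eventually_all S).2 fun g _ =>
      (hF.tendsto_card_image_sdiff g).eventually_lt_const hk
  filter_upwards [h1, hF.eventually_nonempty] with n hn hne
  by_contra! hlt
  have hpos : (0 : ℝ) < (F n).card := by exact_mod_cast hne.card_pos
  obtain ⟨f, hf⟩ := hne
  have hsub : S.image (fun g => g + f) ⊆ F n := by
    intro x hx
    obtain ⟨g, hg, rfl⟩ := Finset.mem_image.1 hx
    by_contra hnot
    have h2 : 1 ≤ (((F n).image (fun x => g + x)) \ F n).card :=
      Finset.card_pos.2 ⟨g + f, Finset.mem_sdiff.2 ⟨Finset.mem_image_of_mem _ hf, hnot⟩⟩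
    have h3 := hn g hg
    rw [div_lt_div_iff₀ hpos (by positivity)] at h3
    have h4 : (1 : ℝ) ≤ (((F n).image (fun x => g + x)) \ F n).card := by exact_mod_cast h2
    have h5 : ((F n).card : ℝ) < k := by exact_mod_cast hlt
    nlinarith
  have := Finset.card_le_card hsub
  rw [Finset.card_image_of_injective _ (add_left_injective f), hS] at this
  omega

variable {Q : Type*} [AddCommGroup Q]

-- Translation by g carries the fibre over q into the fibre over π g + q, except for the points that
-- leave F.
open Classical in
theorem card_fiber_le_card_fiber_add (π : G →+ Q) (F : Finset G) (g : G) (q : Q) :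
    (F.filter (fun a => π a = q)).card ≤ (F.filter (fun a => π a = π g + q)).card +
      ((F.image (fun x => g + x)) \ F).card := by
  rw [← Finset.card_image_of_injective (F.filter (fun a => π a = q)) (add_right_injective g)]
  refine (Finset.card_le_card ?_).trans (Finset.card_union_le _ _)
  intro x hx
  obtain ⟨a, ha, rfl⟩ := Finset.mem_image.1 hx
  rw [Finset.mem_filter] at ha
  by_cases hx : g + a ∈ F
  · exact Finset.mem_union_left _ (Finset.mem_filter.2 ⟨hx, by rw [map_add, ha.2]⟩)
  · exact Finset.mem_union_right _
      (Finset.mem_sdiff.2 ⟨Finset.mem_image_of_mem _ ha.1, hx⟩)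

open Classical in
/-- Along a Følner sequence the fibres of a homomorphism onto a finite group are
equidistributed (upper bound). -/
theorem IsFolnerSeq.eventually_card_preimage_le [Fintype Q] {F : ℕ → Finset G}
    (hF : IsFolnerSeq F) (π : G →+ Q) (hπ : Function.Surjective π) (T : Finset Q)
    {ε : ℝ} (hε : 0 < ε) :
    ∀ᶠ n in atTop, (((F n).filter (fun a => π a ∈ T)).card : ℝ) ≤
      (T.card / Fintype.card Q + ε) * (F n).card := by
  choose σ hσ using hπ
  have hQ : (0 : ℝ) < Fintype.card Q := by exact_mod_cast Fintype.card_pos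
  -- An error δ for each class of T adds up to at most ε; the `+ 1` covers empty T.
  set δ : ℝ := ε / (T.card + 1) with hδ
  have hδ0 : 0 < δ := by positivity
  have h1 : ∀ᶠ n in atTop, ∀ g : Q,
      ((((F n).image (fun x => σ g + x)) \ F n).card : ℝ) / ((F n).card : ℝ) < δ :=
    eventually_all.2 fun g => (hF.tendsto_card_image_sdiff (σ g)).eventually_lt_const hδ0
  filter_upwards [h1, hF.eventually_nonempty] with n hn hne
  have hpos : (0 : ℝ) < (F n).card := by exact_mod_cast hne.card_pos
  have hsum : ∑ q : Q, (((F n).filter (fun a => π a = q)).card : ℝ) = (F n).card := by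
    have := Finset.card_eq_sum_card_fiberwise (f := π) (s := F n) (t := Finset.univ)
      (fun _ _ => Finset.mem_univ _)
    exact_mod_cast this.symm
  have hone : ∀ q : Q, (((F n).filter (fun a => π a = q)).card : ℝ) ≤
      (F n).card / Fintype.card Q + δ * (F n).card := by
    intro q
    -- Compare the fibre over q with all its translates and average: the fibres over g + q partition
    -- F n.
    have h2 : ∑ g : Q, (((F n).filter (fun a => π a = q)).card : ℝ) ≤
        ∑ g : Q, ((((F n).filter (fun a => π a = g + q)).card : ℝ) + δ * (F n).card) := by
      refine Finset.sum_le_sum fun g _ => ?_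
      have h3 := card_fiber_le_card_fiber_add π (F n) (σ g) q
      rw [hσ] at h3
      have h4 : (((F n).filter (fun a => π a = q)).card : ℝ) ≤
          ((F n).filter (fun a => π a = g + q)).card +
          (((F n).image (fun x => σ g + x)) \ F n).card := by exact_mod_cast h3
      have h5 := hn g
      rw [div_lt_iff₀ hpos] at h5
      linarith
    have h2' : ∑ g : Q, (((F n).filter (fun a => π a = g + q)).card : ℝ) = (F n).card :=
      (Equiv.sum_comp (Equiv.addRight q)
        (fun g => (((F n).filter (fun a => π a = g)).card : ℝ))).trans hsum
    rw [Finset.sum_add_distrib, h2'] at h2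
    simp only [Finset.sum_const, Finset.card_univ, nsmul_eq_mul] at h2
    rw [← sub_nonneg]
    have : (F n).card / Fintype.card Q + δ * (F n).card -
        (((F n).filter (fun a => π a = q)).card : ℝ) =
        ((F n).card + Fintype.card Q * (δ * (F n).card) -
          Fintype.card Q * ((F n).filter (fun a => π a = q)).card) / Fintype.card Q := by
      field_simp
    rw [this]
    exact div_nonneg (by linarith) hQ.le
  have h6 : (((F n).filter (fun a => π a ∈ T)).card : ℝ) =
      ∑ q ∈ T, (((F n).filter (fun a => π a = q)).card : ℝ) := by
    have := Finset.card_eq_sum_card_fiberwise (f := π) (s := (F n).filter (fun a => π a ∈ T))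
      (t := T) (fun a ha => (Finset.mem_filter.1 ha).2)
    rw [this]
    push_cast
    refine Finset.sum_congr rfl fun q hq => ?_
    congr 2
    ext a
    simp only [Finset.mem_filter]
    constructor
    · rintro ⟨⟨h, -⟩, rfl⟩
      exact ⟨h, rfl⟩
    · rintro ⟨h, rfl⟩
      exact ⟨⟨h, hq⟩, rfl⟩
  have h7 : T.card * δ ≤ ε := by
    rw [hδ, mul_div_assoc', div_le_iff₀ (by positivity)]
    nlinarith
  calc (((F n).filter (fun a => π a ∈ T)).card : ℝ)
      ≤ ∑ q ∈ T, ((F n).card / Fintype.card Q + δ * (F n).card : ℝ) := by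
        rw [h6]
        exact Finset.sum_le_sum fun q _ => hone q
    _ = (T.card / Fintype.card Q + T.card * δ) * (F n).card := by
        rw [Finset.sum_const, nsmul_eq_mul]
        ring
    _ ≤ _ := by gcongr

open Classical in
theorem IsFolnerSeq.eventually_card_image₂_sdiff_le {F : ℕ → Finset G} (hF : IsFolnerSeq F)
    (W : Finset G) {ε : ℝ} (hε : 0 < ε) :
    ∀ᶠ n in atTop, (((Finset.image₂ (fun w a => w + a) W (F n)) \ F n).card : ℝ) ≤
      ε * (F n).card := by
  set δ : ℝ := ε / (W.card + 1) with hδ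
  have hδ0 : 0 < δ := by positivity
  have h1 : ∀ᶠ n in atTop, ∀ g ∈ W,
      ((((F n).image (fun x => g + x)) \ F n).card : ℝ) / ((F n).card : ℝ) < δ :=
    (Finset.eventually_all W).2 fun g _ =>
      (hF.tendsto_card_image_sdiff g).eventually_lt_const hδ0
  filter_upwards [h1, hF.eventually_nonempty] with n hn hne
  have hpos : (0 : ℝ) < (F n).card := by exact_mod_cast hne.card_pos
  have hsub : (Finset.image₂ (fun w a => w + a) W (F n)) \ F n ⊆
      W.biUnion fun g => ((F n).image (fun x => g + x)) \ F n := by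
    intro x hx
    rw [Finset.mem_sdiff, Finset.mem_image₂] at hx
    obtain ⟨⟨w, hw, a, ha, rfl⟩, hx⟩ := hx
    exact Finset.mem_biUnion.2 ⟨w, hw, Finset.mem_sdiff.2 ⟨Finset.mem_image_of_mem _ ha, hx⟩⟩
  have h2 := (Finset.card_le_card hsub).trans Finset.card_biUnion_le
  have h7 : W.card * δ ≤ ε := by
    rw [hδ, mul_div_assoc', div_le_iff₀ (by positivity)]
    nlinarith
  calc (((Finset.image₂ (fun w a => w + a) W (F n)) \ F n).card : ℝ)
      ≤ ∑ g ∈ W, ((((F n).image (fun x => g + x)) \ F n).card : ℝ) := by exact_mod_cast h2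
    _ ≤ ∑ g ∈ W, δ * (F n).card := Finset.sum_le_sum fun g hg => by
        have := hn g hg
        rw [div_lt_iff₀ hpos] at this
        exact this.le
    _ = W.card * δ * (F n).card := by
        rw [Finset.sum_const, nsmul_eq_mul]
        ring
    _ ≤ _ := by gcongr

end FolnerSets

/-! ### Counting patterns and bounding subcovers -/

section Patterns

variable {G : Type*}

open Classical in
/-- The supports in `A` of the points of `Y`. -/
noncomputable def patterns (Y : Set (FullShift G)) (A : Finset G) : Finset (Finset G) :=
  A.powerset.filter fun S => ∃ y ∈ Y, ∀ a ∈ A, a ∈ S ↔ y a ≠ 0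

open Classical in
theorem filter_mem_patterns {Y : Set (FullShift G)} (A : Finset G) {y : FullShift G}
    (hy : y ∈ Y) : A.filter (fun a => y a ≠ 0) ∈ patterns Y A := by
  refine Finset.mem_filter.2 ⟨Finset.mem_powerset.2 (Finset.filter_subset _ _), y, hy, ?_⟩
  intro a ha
  simp [ha]

-- A pattern is a subset of A ∩ π⁻¹(T) for some T with at most m elements. There are at most 2^|Q|
-- such T, a factor independent of A.
open Classical in
theorem card_patterns_le {Q : Type*} [Fintype Q] (π : G → Q) (m : ℕ)
    {Y : Set (FullShift G)}
    (hY : ∀ y ∈ Y, ∃ T : Finset Q, T.card ≤ m ∧ ∀ a, y a ≠ 0 → π a ∈ T)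
    (A : Finset G) {r : ℝ}
    (hA : ∀ T : Finset Q, T.card ≤ m → ((A.filter (fun a => π a ∈ T)).card : ℝ) ≤ r) :
    ((patterns Y A).card : ℝ) ≤ (2 : ℝ) ^ Fintype.card Q * (2 : ℝ) ^ r := by
  have hsub : patterns Y A ⊆ (Finset.univ.filter fun T : Finset Q => T.card ≤ m).biUnion
      fun T => (A.filter (fun a => π a ∈ T)).powerset := by
    intro S hS
    obtain ⟨hSA, y, hy, hyS⟩ := Finset.mem_filter.1 hS
    rw [Finset.mem_powerset] at hSA
    obtain ⟨T, hT, hTy⟩ := hY y hy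
    refine Finset.mem_biUnion.2 ⟨T, Finset.mem_filter.2 ⟨Finset.mem_univ _, hT⟩,
      Finset.mem_powerset.2 fun a ha => ?_⟩
    exact Finset.mem_filter.2 ⟨hSA ha, hTy a ((hyS a (hSA ha)).1 ha)⟩
  have h1 := (Finset.card_le_card hsub).trans Finset.card_biUnion_le
  calc ((patterns Y A).card : ℝ)
      ≤ ∑ T ∈ Finset.univ.filter (fun T : Finset Q => T.card ≤ m),
          (((A.filter (fun a => π a ∈ T)).powerset.card : ℕ) : ℝ) := by exact_mod_cast h1
    _ ≤ ∑ T ∈ Finset.univ.filter (fun T : Finset Q => T.card ≤ m), (2 : ℝ) ^ r := by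
        refine Finset.sum_le_sum fun T hT => ?_
        rw [Finset.card_powerset]
        push_cast
        rw [← Real.rpow_natCast]
        exact Real.rpow_le_rpow_of_exponent_le one_le_two (hA T (Finset.mem_filter.1 hT).2)
    _ = ((Finset.univ.filter (fun T : Finset Q => T.card ≤ m)).card : ℝ) * (2 : ℝ) ^ r := by
        rw [Finset.sum_const, nsmul_eq_mul]
    _ ≤ _ := by
        gcongr
        have h2 := Finset.card_filter_le (Finset.univ : Finset (Finset Q)) (fun T => T.card ≤ m)
        rw [Finset.card_univ, Fintype.card_finset] at h2
        exact_mod_cast h2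

/-- A Lebesgue number for the cover: each point has a cylinder inside a member of U, finitely many
cylinders cover the compact Y, and W is the union of their windows. -/
theorem exists_window {Y : Set (FullShift G)} (hY : IsClosed Y) {U : Set (Set Y)}
    (hU : ∀ u ∈ U, IsOpen u) (hcov : ⋃₀ U = Set.univ) :
    ∃ W : Finset G, ∀ y : Y, ∃ u ∈ U, ∀ y' : Y,
      (∀ w ∈ W, (y' : FullShift G) w = (y : FullShift G) w) → y' ∈ u := by
  classical
  have : CompactSpace (FullShift G) := inferInstanceAs (CompactSpace (G → Fin 2))
  have : CompactSpace Y := isCompact_iff_compactSpace.1 hY.isCompact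
  have h1 : ∀ y : Y, ∃ W : Finset G, ∃ u ∈ U, ∀ y' : Y,
      (∀ w ∈ W, (y' : FullShift G) w = (y : FullShift G) w) → y' ∈ u := by
    intro y
    obtain ⟨u, hu, hyu⟩ := Set.mem_sUnion.1 (hcov ▸ Set.mem_univ y : y ∈ ⋃₀ U)
    obtain ⟨O, hO, rfl⟩ := isOpen_induced_iff.1 (hU u hu)
    obtain ⟨I, v, hv, hsub⟩ := isOpen_pi_iff.1 (show IsOpen (O : Set (G → Fin 2)) from hO)
      (y : FullShift G) hyu
    refine ⟨I, _, hu, fun y' hy' => hsub fun i hi => ?_⟩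
    rw [hy' i hi]
    exact (hv i hi).2
  choose W u hu hW using h1
  have hopen : ∀ y : Y, IsOpen {y' : Y | ∀ w ∈ W y, (y' : FullShift G) w = (y : FullShift G) w} := by
    intro y
    have : {y' : Y | ∀ w ∈ W y, (y' : FullShift G) w = (y : FullShift G) w} =
        ⋂ w ∈ W y, {y' : Y | (y' : FullShift G) w = (y : FullShift G) w} := by
      ext; simp
    rw [this]
    refine isOpen_biInter_finset fun w _ => ?_
    have hc : Continuous fun y' : Y => ((y' : FullShift G) w : Fin 2) :=
      (continuous_apply (A := fun _ : G => Fin 2) w).comp continuous_subtype_val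
    exact (isOpen_discrete {((y : FullShift G) w : Fin 2)}).preimage hc
  obtain ⟨t, ht⟩ := isCompact_univ.elim_finite_subcover _ hopen
    (fun y _ => Set.mem_iUnion.2 ⟨y, fun _ _ => rfl⟩)
  refine ⟨t.biUnion W, fun y => ?_⟩
  obtain ⟨z, hz, hyz⟩ := Set.mem_iUnion₂.1 (ht (Set.mem_univ y))
  refine ⟨u z, hu z, fun y' hy' => hW z y' fun w hw => ?_⟩
  rw [hy' w (Finset.mem_biUnion.2 ⟨z, hz, hw⟩)]
  exact hyz w hw

theorem fin_two_eq_of_ne_zero_iff {i j : Fin 2} (h : i ≠ 0 ↔ j ≠ 0) : i = j := by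
  revert i j
  decide

-- Two points with the same pattern on W + F have F-translates that agree on W. One representative
-- per pattern therefore selects enough members of the join.
open Classical in
theorem exists_subcover_card_le [AddCommGroup G] (Y : SubAddAction G (FullShift G))
    {U : Set (Set Y)} {W : Finset G}
    (hW : ∀ y : Y, ∃ u ∈ U, ∀ y' : Y,
      (∀ w ∈ W, (y' : FullShift G) w = (y : FullShift G) w) → y' ∈ u) (F : Finset G) :
    ∃ V : Finset (Set Y), (V : Set (Set Y)) ⊆ coverJoin F U ∧ ⋃₀ (V : Set (Set Y)) = Set.univ ∧
      V.card ≤ (patterns (Y : Set (FullShift G))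
        (Finset.image₂ (fun w a => w + a) W F)).card := by
  set A := Finset.image₂ (fun w a => w + a) W F with hA
  choose u hu hWu using hW
  have h1 : ∀ S : patterns (Y : Set (FullShift G)) A, ∃ y : Y,
      ∀ a ∈ A, a ∈ S.1 ↔ (y : FullShift G) a ≠ 0 := fun S => by
    obtain ⟨-, y, hy, h⟩ := Finset.mem_filter.1 S.2
    exact ⟨⟨y, hy⟩, h⟩
  choose y hy using h1
  refine ⟨(Finset.univ : Finset (patterns (Y : Set (FullShift G)) A)).image
    fun S => {x : Y | ∀ a ∈ F, a +ᵥ x ∈ u (a +ᵥ y S)}, ?_, ?_, ?_⟩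
  · intro v hv
    obtain ⟨S, -, rfl⟩ := Finset.mem_image.1 (Finset.mem_coe.1 hv)
    exact ⟨fun a => u (a +ᵥ y S), fun a _ => hu _, rfl⟩
  · refine Set.eq_univ_of_forall fun x => ?_
    let S : patterns (Y : Set (FullShift G)) A := ⟨_, filter_mem_patterns A x.2⟩
    refine Set.mem_sUnion.2 ⟨_, Finset.mem_coe.2 (Finset.mem_image_of_mem _ (Finset.mem_univ S)),
      fun a ha => hWu _ _ fun w hw => ?_⟩
    have hwa : w + a ∈ A := Finset.mem_image₂_of_mem hw ha
    change (x : FullShift G) (w + a) = (y S : FullShift G) (w + a)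
    refine fin_two_eq_of_ne_zero_iff ?_
    rw [← hy S _ hwa]
    simp [S, hwa]
  · refine Finset.card_image_le.trans ?_
    simp

/-- For the partition by the value at 0, a member of the join prescribes every coordinate in F.
Distinct configurations supported in B ⊆ F thus need distinct members. -/
theorem exists_cover_two_pow_le [AddCommGroup G] (Y : SubAddAction G (FullShift G)) :
    ∃ U : Set (Set Y), (∀ u ∈ U, IsOpen u) ∧ ⋃₀ U = Set.univ ∧
      ∀ F B : Finset G, B ⊆ F → (∀ x : FullShift G, (∀ a, x a ≠ 0 → a ∈ B) → x ∈ Y) →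
        2 ^ B.card ≤ minSubcover (coverJoin F U) := by
  classical
  refine ⟨Set.range fun i : Fin 2 => {y : Y | (y : FullShift G) 0 = i}, ?_, ?_, ?_⟩
  · rintro _ ⟨i, rfl⟩
    have hc : Continuous fun y' : Y => ((y' : FullShift G) 0 : Fin 2) :=
      (continuous_apply (A := fun _ : G => Fin 2) 0).comp continuous_subtype_val
    exact (isOpen_discrete {i}).preimage hc
  · exact Set.eq_univ_of_forall fun y => Set.mem_sUnion.2 ⟨_, ⟨_, rfl⟩, rfl⟩
  · intro F B hBF hB
    refine le_csInf ?_ ?_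
    -- A finite subcover must be exhibited, since `sInf ∅ = 0` would defeat the bound; the window is
    -- {0}.
    · obtain ⟨V, hV, hV', -⟩ := exists_subcover_card_le Y
        (U := Set.range fun i : Fin 2 => {y : Y | (y : FullShift G) 0 = i}) (W := {0})
        (fun y => ⟨_, ⟨(y : FullShift G) 0, rfl⟩, fun y' hy' => hy' 0 (by simp)⟩) F
      exact ⟨_, V, hV, hV', rfl⟩
    · rintro n ⟨V, hV, hcov, rfl⟩
      rw [← Finset.card_powerset]
      have h1 : ∀ S : Finset G, ∃ y : FullShift G, ∀ a, y a ≠ 0 ↔ a ∈ S := fun S =>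
        ⟨fun a => if a ∈ S then 1 else 0, fun a => by
          change (if a ∈ S then (1 : Fin 2) else 0) ≠ 0 ↔ a ∈ S
          split_ifs with h <;> simp [h]⟩
      choose y hy using h1
      have hyY : ∀ S ∈ B.powerset, y S ∈ Y := fun S hS =>
        hB _ fun a ha => Finset.mem_powerset.1 hS ((hy S a).1 ha)
      have h2 : ∀ S ∈ B.powerset, ∃ v ∈ V, ∃ h : y S ∈ Y, (⟨y S, h⟩ : Y) ∈ v := by
        intro S hS
        obtain ⟨v, hv, hyv⟩ := Set.mem_sUnion.1
          (hcov ▸ Set.mem_univ (⟨y S, hyY S hS⟩ : Y) : _ ∈ ⋃₀ (V : Set (Set Y)))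
        exact ⟨v, hv, hyY S hS, hyv⟩
      choose! v hv hYm hyv using h2
      refine Finset.card_le_card_of_injOn v hv ?_
      intro S hS S' hS' hSS'
      have m1 := hyv S hS
      have m2 := hyv S' hS'
      rw [← hSS'] at m2
      obtain ⟨φ, hφ, hvφ⟩ := hV (hv S hS)
      rw [hvφ] at m1 m2
      have key : ∀ a ∈ F, y S a = y S' a := by
        intro a ha
        obtain ⟨i, hi⟩ := hφ a ha
        have e1 := m1 a ha
        have e2 := m2 a ha
        rw [← hi] at e1 e2
        change y S (0 + a) = i at e1
        change y S' (0 + a) = i at e2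
        rw [zero_add] at e1 e2
        rw [e1, e2]
      ext a
      by_cases ha : a ∈ F
      · rw [← hy S, ← hy S', key a ha]
      · have n1 : a ∉ S := fun h => ha (hBF (Finset.mem_powerset.1 hS h))
        have n2 : a ∉ S' := fun h => ha (hBF (Finset.mem_powerset.1 hS' h))
        simp [n1, n2]

end Patterns

/-! ### From counting to entropy bounds -/

section EntropyBounds

variable {G : Type*} [AddCommGroup G]

theorem coverEntropy_le [Infinite G] {Y : SubAddAction G (FullShift G)}
    (hYc : IsClosed (Y : Set (FullShift G))) {Q : Type*} [AddCommGroup Q] [Fintype Q]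
    (π : G →+ Q) (hπ : Function.Surjective π) (m : ℕ)
    (hY : ∀ y ∈ Y, ∃ T : Finset Q, T.card ≤ m ∧ ∀ a, y a ≠ 0 → π a ∈ T)
    {F : ℕ → Finset G} (hF : IsFolnerSeq F) {U : Set (Set Y)}
    (hU : ∀ u ∈ U, IsOpen u) (hcov : ⋃₀ U = Set.univ)
    {c : ℝ} (hc : (m : ℝ) / Fintype.card Q < c) : coverEntropy F U ≤ c := by
  classical
  obtain ⟨W, hW⟩ := exists_window hYc hU hcov
  -- One third of the gap each for equidistribution, for the boundary of W + F n, and for the factor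
  -- 2^|Q|.
  set ε : ℝ := (c - (m : ℝ) / Fintype.card Q) / 3 with hεdef
  have hε : 0 < ε := by rw [hεdef]; linarith
  have h1 : ∀ᶠ n in atTop, ∀ T : Finset Q,
      (((F n).filter (fun a => π a ∈ T)).card : ℝ) ≤
        (T.card / Fintype.card Q + ε) * (F n).card :=
    eventually_all.2 fun T => hF.eventually_card_preimage_le π hπ T hε
  have h2 := hF.eventually_card_image₂_sdiff_le W hε
  have h3 := hF.tendsto_card.eventually_ge_atTop ((Fintype.card Q : ℝ) / ε)
  refine limsup_le_of_le (by isBoundedDefault) ?_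
  filter_upwards [h1, h2, h3, hF.eventually_nonempty] with n h1 h2 h3 hne
  have hpos : (0 : ℝ) < (F n).card := by exact_mod_cast hne.card_pos
  set A := Finset.image₂ (fun w a => w + a) W (F n) with hA
  set f : ℝ := ((F n).card : ℝ)
  have hA' : ∀ T : Finset Q, T.card ≤ m → ((A.filter (fun a => π a ∈ T)).card : ℝ) ≤
      ((m : ℝ) / Fintype.card Q + 2 * ε) * f := by
    intro T hT
    have hsub : A.filter (fun a => π a ∈ T) ⊆ (F n).filter (fun a => π a ∈ T) ∪ (A \ F n) := by
      intro a ha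
      rw [Finset.mem_filter] at ha
      by_cases haF : a ∈ F n
      · exact Finset.mem_union_left _ (Finset.mem_filter.2 ⟨haF, ha.2⟩)
      · exact Finset.mem_union_right _ (Finset.mem_sdiff.2 ⟨ha.1, haF⟩)
    have h4 : ((A.filter (fun a => π a ∈ T)).card : ℝ) ≤
        ((F n).filter (fun a => π a ∈ T)).card + (A \ F n).card := by
      exact_mod_cast (Finset.card_le_card hsub).trans (Finset.card_union_le _ _)
    have h5 : (T.card : ℝ) / Fintype.card Q ≤ (m : ℝ) / Fintype.card Q := by gcongr
    have h6 := h1 T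
    nlinarith [mul_le_mul_of_nonneg_right h5 hpos.le]
  obtain ⟨V, hV, hVc, hVcard⟩ := exists_subcover_card_le Y hW (F n)
  have hmin : minSubcover (coverJoin (F n) U) ≤ (patterns (Y : Set (FullShift G)) A).card := by
    refine le_trans (Nat.sInf_le ?_) hVcard
    exact ⟨V, hV, hVc, rfl⟩
  have hmin' : (minSubcover (coverJoin (F n) U) : ℝ) ≤
      (2 : ℝ) ^ ((Fintype.card Q : ℝ) + ((m : ℝ) / Fintype.card Q + 2 * ε) * f) := by
    rw [Real.rpow_add two_pos, Real.rpow_natCast]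
    exact le_trans (by exact_mod_cast hmin) (card_patterns_le π m hY A hA')
  have hcQ : (Fintype.card Q : ℝ) ≤ ε * f := by
    rw [div_le_iff₀ hε] at h3
    linarith
  have hle : (Fintype.card Q : ℝ) + ((m : ℝ) / Fintype.card Q + 2 * ε) * f ≤ c * f := by
    have : c = (m : ℝ) / Fintype.card Q + 3 * ε := by rw [hεdef]; ring
    rw [this]
    linarith
  have hlog : Real.logb 2 (minSubcover (coverJoin (F n) U)) ≤ c * f := by
    rcases Nat.eq_zero_or_pos (minSubcover (coverJoin (F n) U)) with h0 | h0
    · rw [h0, Nat.cast_zero, Real.logb_zero]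
      exact le_trans (by positivity) hle
    · rw [Real.logb_le_iff_le_rpow one_lt_two (by exact_mod_cast h0)]
      exact hmin'.trans (Real.rpow_le_rpow_of_exponent_le one_le_two hle)
  exact EReal.coe_le_coe_iff.2 ((div_le_iff₀ hpos).2 hlog)

theorem le_topEntropy {Y : SubAddAction G (FullShift G)} {F : ℕ → Finset G}
    (hF : IsFolnerSeq F) {c : ℝ}
    (hY : ∀ F : Finset G, ∃ B ⊆ F, c * F.card ≤ B.card ∧
      ∀ x : FullShift G, (∀ a, x a ≠ 0 → a ∈ B) → x ∈ Y) :
    (c : EReal) ≤ topEntropy F Y := by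
  obtain ⟨U, hU, hcov, h⟩ := exists_cover_two_pow_le Y
  refine le_trans ?_ (le_iSup₂_of_le U hU (le_iSup_of_le hcov le_rfl))
  refine le_limsup_of_frequently_le (Eventually.frequently ?_) (by isBoundedDefault)
  filter_upwards [hF.eventually_nonempty] with n hne
  have hpos : (0 : ℝ) < (F n).card := by exact_mod_cast hne.card_pos
  obtain ⟨B, hBF, hcB, hB⟩ := hY (F n)
  refine EReal.coe_le_coe_iff.2 ((le_div_iff₀ hpos).2 (hcB.trans ?_))
  have h1 : (2 : ℝ) ^ (B.card : ℝ) ≤ (minSubcover (coverJoin (F n) U) : ℝ) := by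
    rw [Real.rpow_natCast]
    exact_mod_cast h (F n) B hBF hB
  rwa [Real.le_logb_iff_rpow_le one_lt_two (lt_of_lt_of_le (by positivity) h1)]

end EntropyBounds

/-! ### Deleting residue classes greedily -/

section Avoidance

open Classical in
/-- A translate of a set of `k` classes meets `A` in at most the average number of points. -/
theorem exists_avoiding_classes {G Q : Type*} [AddCommGroup Q] [Fintype Q] (π : G → Q)
    {k : ℕ} (hk : k ≤ Fintype.card Q) (A : Finset G) :
    ∃ Z : Finset Q, Z.card = k ∧
      (1 - (k : ℝ) / Fintype.card Q) * A.card ≤ (A.filter (fun a => π a ∉ Z)).card := by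
  obtain ⟨Z₀, -, hZ₀⟩ := Finset.exists_subset_card_eq (s := (Finset.univ : Finset Q))
    (n := k) (by rwa [Finset.card_univ])
  have hQ : (0 : ℝ) < Fintype.card Q := by exact_mod_cast Fintype.card_pos
  have hshift : ∀ q : Q, (Finset.univ.filter fun t => q + t ∈ Z₀).card = k := by
    intro q
    rw [← hZ₀, ← Finset.card_image_of_injective _ (add_right_injective q)]
    congr 1
    ext z
    simp only [Finset.mem_image, Finset.mem_filter, Finset.mem_univ, true_and]
    exact ⟨by rintro ⟨t, ht, rfl⟩; exact ht, fun hz => ⟨-q + z, by simpa using hz, by simp⟩⟩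
  -- Double counting: each point of A is hit by exactly k of the |Q| translates of Z₀.
  have hsum : ∑ t : Q, Fintype.card Q * (A.filter (fun a => π a + t ∈ Z₀)).card ≤
      ∑ _t : Q, A.card * k := by
    have h1 : ∑ t : Q, (A.filter (fun a => π a + t ∈ Z₀)).card = A.card * k := by
      simp_rw [Finset.card_filter]
      rw [Finset.sum_comm]
      simp_rw [← Finset.card_filter, hshift]
      rw [Finset.sum_const, smul_eq_mul]
    rw [← Finset.mul_sum, h1, Finset.sum_const, Finset.card_univ, smul_eq_mul]
  obtain ⟨t, -, ht⟩ := Finset.exists_le_of_sum_le Finset.univ_nonempty hsum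
  refine ⟨Finset.univ.filter fun q => q + t ∈ Z₀, ?_, ?_⟩
  · simp_rw [add_comm _ t]
    exact hshift t
  · have h2 := Finset.card_filter_add_card_filter_not (s := A) (fun a => π a + t ∈ Z₀)
    have h3 : ((A.filter (fun a => π a + t ∈ Z₀)).card : ℝ) +
        (A.filter (fun a => π a + t ∉ Z₀)).card = A.card := by exact_mod_cast h2
    have h4 : (Fintype.card Q : ℝ) * (A.filter (fun a => π a + t ∈ Z₀)).card ≤ A.card * k := by
      exact_mod_cast ht
    simp only [Finset.mem_filter, Finset.mem_univ, true_and]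
    have h5 : ((A.filter (fun a => π a + t ∈ Z₀)).card : ℝ) ≤ A.card * k / Fintype.card Q := by
      rw [le_div_iff₀ hQ]
      linarith
    have h6 : (1 - (k : ℝ) / Fintype.card Q) * A.card = A.card - A.card * k / Fintype.card Q := by
      ring
    linarith

/-- Stage l keeps at least the fraction 1 - k l/|Q l|. The decreasing finite sets are eventually
constant, so one set B serves all l at once. -/
theorem exists_subset_avoiding_classes {G : Type*} {Q : ℕ → Type*} [∀ l, AddCommGroup (Q l)]
    [∀ l, Fintype (Q l)] (π : ∀ l, G → Q l) {k : ℕ → ℕ} (hk : ∀ l, k l ≤ Fintype.card (Q l))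
    {c : ℝ} (hc : ∀ n, c ≤ ∏ l ∈ Finset.range n, (1 - (k l : ℝ) / Fintype.card (Q l)))
    (F : Finset G) :
    ∃ B ⊆ F, c * F.card ≤ B.card ∧
      ∀ l, ∃ Z : Finset (Q l), Z.card = k l ∧ ∀ a ∈ B, π l a ∉ Z := by
  classical
  choose Z hZcard hZ using fun (l : ℕ) (A : Finset G) => exists_avoiding_classes (π l) (hk l) A
  let A : ℕ → Finset G := fun n =>
    Nat.rec F (fun l A => A.filter fun a => π l a ∉ Z l A) n
  have hA : ∀ l, A (l + 1) = (A l).filter fun a => π l a ∉ Z l (A l) := fun l => rfl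
  have hanti : Antitone A := antitone_nat_of_succ_le fun l => by
    rw [hA]
    exact Finset.filter_subset _ _
  have hcard : ∀ n, (∏ l ∈ Finset.range n, (1 - (k l : ℝ) / Fintype.card (Q l))) * F.card ≤
      (A n).card := by
    intro n
    induction n with
    | zero => simp [A]
    | succ n ih =>
      rw [Finset.prod_range_succ, hA]
      refine le_trans ?_ (hZ n (A n))
      have h0 : 0 ≤ 1 - (k n : ℝ) / Fintype.card (Q n) :=
        sub_nonneg.2 (div_le_one_of_le₀ (by exact_mod_cast hk n) (by positivity))
      nlinarith [mul_le_mul_of_nonneg_left ih h0]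
  -- A stage of minimal cardinality: no later stage removes anything.
  let m := Function.argmin fun n => (A n).card
  have hm : ∀ n, (A m).card ≤ (A n).card := fun n =>
    Function.argmin_le (fun n => (A n).card) n
  refine ⟨A m, hanti (Nat.zero_le m), ?_, fun l => ⟨Z l (A l), hZcard l _, fun a ha => ?_⟩⟩
  · exact le_trans (by gcongr; exact hc m) (hcard m)
  · have heq : A (max m (l + 1)) = A m :=
      Finset.eq_of_subset_of_card_le (hanti (le_max_left _ _)) (hm _)
    rw [← heq] at ha
    have := hanti (le_max_right m (l + 1)) ha
    rw [hA] at this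
    exact (Finset.mem_filter.1 this).2

end Avoidance

/-! ### Residue counts and closedness -/

section ResCount

variable {R : Type*} [CommRing R]

/-- The quotient has finitely many subsets T, and requiring the support to lie over T is a closed
condition on coordinates. -/
theorem isClosed_resCount_le (𝔞 : Ideal R) [Finite (R ⧸ 𝔞)] (n : ℕ) :
    IsClosed {x : FullShift R | resCount 𝔞 (supp x) ≤ n} := by
  have h : {x : FullShift R | resCount 𝔞 (supp x) ≤ n} =
      ⋃ T ∈ {T : Set (R ⧸ 𝔞) | T.ncard ≤ n},
        ⋂ a ∈ {a : R | Ideal.Quotient.mk 𝔞 a ∉ T}, {x : FullShift R | x a = 0} := by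
    ext x
    simp only [Set.mem_iUnion, Set.mem_iInter, Set.mem_ofPred_eq, exists_prop]
    constructor
    · intro hx
      exact ⟨_, hx, fun a ha => by_contra fun h => ha ⟨a, h, rfl⟩⟩
    · rintro ⟨T, hT, hx⟩
      refine (Set.ncard_le_ncard ?_ (Set.toFinite T)).trans hT
      rintro _ ⟨a, ha, rfl⟩
      exact by_contra fun h => ha (hx a h)
  rw [h]
  refine Set.Finite.isClosed_biUnion (Set.toFinite _) fun T _ =>
    isClosed_biInter fun a _ => ?_
  have hc : Continuous fun x : FullShift R => (x a : Fin 2) :=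
    continuous_apply (A := fun _ : R => Fin 2) a
  exact (isClosed_discrete {(0 : Fin 2)}).preimage hc

theorem resCount_add_card_le (𝔞 : Ideal R) [Fintype (R ⧸ 𝔞)] {x : FullShift R}
    {Z : Finset (R ⧸ 𝔞)} (hZ : ∀ a, x a ≠ 0 → Ideal.Quotient.mk 𝔞 a ∉ Z) :
    resCount 𝔞 (supp x) + Z.card ≤ Fintype.card (R ⧸ 𝔞) := by
  classical
  have h : resCount 𝔞 (supp x) ≤ Zᶜ.card := by
    rw [← Set.ncard_coe_finset]
    refine Set.ncard_le_ncard ?_ (Set.toFinite _)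
    rintro _ ⟨a, ha, rfl⟩
    simpa using hZ a ha
  rw [Finset.card_compl] at h
  have := Finset.card_le_univ Z
  omega

end ResCount

/-- As `1 ≤ s l`, the strict inequality of admissibility is already implied. -/
theorem mem_YGe_iff {K : Type*} [Field K] [NumberField K] {𝔟 : ℕ → Ideal (𝓞 K)} {s : ℕ → ℕ}
    (hs : ∀ l, 1 ≤ s l) {x : FullShift (𝓞 K)} :
    x ∈ YGe 𝔟 s ↔ ∀ l, resCount (𝔟 l) (supp x) + s l ≤ Ideal.absNorm (𝔟 l) := by
  constructor
  · intro h l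
    have := h.2 l
    omega
  · intro h
    refine ⟨fun l => ?_, fun l => ?_⟩
    · have := h l
      have := hs l
      omega
    · have := h l
      omega

/-- T is the box whose sides are the images of the support in the separate quotients. -/
theorem exists_finset_quotients {R : Type*} [CommRing R] (𝔟 : ℕ → Ideal R)
    [∀ l, Fintype (R ⧸ 𝔟 l)] {s : ℕ → ℕ} (n : ℕ) {x : FullShift R}
    (hx : ∀ l, resCount (𝔟 l) (supp x) + s l ≤ Fintype.card (R ⧸ 𝔟 l)) :
    ∃ T : Finset (∀ l : Fin n, R ⧸ 𝔟 l),
      T.card ≤ ∏ l : Fin n, (Fintype.card (R ⧸ 𝔟 l) - s l) ∧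
      ∀ a, x a ≠ 0 → (fun l : Fin n => Ideal.Quotient.mk (𝔟 l) a) ∈ T := by
  classical
  refine ⟨Fintype.piFinset fun l => (Ideal.Quotient.mk (𝔟 l) '' supp x).toFinset, ?_, ?_⟩
  · rw [Fintype.card_piFinset]
    refine Finset.prod_le_prod' fun l _ => ?_
    have := hx l
    rw [resCount, Set.ncard_eq_toFinset_card'] at this
    omega
  · intro a ha
    rw [Fintype.mem_piFinset]
    exact fun l => Set.mem_toFinset.2 ⟨a, ha, rfl⟩

/-- Finite products decrease as factors are added and are bounded below by 0. The limit 0 is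
allowed, as when some s_ℓ = N(𝔟_ℓ). -/
theorem hasProd_iInf_of_mem_Icc {f : ℕ → ℝ} (h0 : ∀ l, 0 ≤ f l) (h1 : ∀ l, f l ≤ 1) :
    HasProd f (⨅ t : Finset ℕ, ∏ l ∈ t, f l) := by
  refine tendsto_atTop_ciInf (Finset.prod_anti_set_of_le_one h0 h1) ⟨0, ?_⟩
  rintro _ ⟨t, rfl⟩
  exact Finset.prod_nonneg fun i _ => h0 i

end BFree

theorem mainTheorem3 {K : Type*} [Field K] [NumberField K]
    (𝔟 : ℕ → Ideal (𝓞 K))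
    (hcoprime : Pairwise fun i j => IsCoprime (𝔟 i) (𝔟 j))
    (hsum : Summable fun ℓ => 1 / (Ideal.absNorm (𝔟 ℓ) : ℝ))
    (s : ℕ → ℕ) (hs_one : ∀ ℓ, 1 ≤ s ℓ) (hs_norm : ∀ ℓ, s ℓ ≤ Ideal.absNorm (𝔟 ℓ)) :
    IsClosed (BFree.YGe 𝔟 s : Set (BFree.FullShift (𝓞 K))) ∧
    (Multipliable fun ℓ => 1 - (s ℓ : ℝ) / (Ideal.absNorm (𝔟 ℓ) : ℝ)) ∧
    ∀ F : ℕ → Finset (𝓞 K), BFree.IsFolnerSeq F →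
      BFree.topEntropy F (BFree.YGe 𝔟 s) =
        ((∏' ℓ, (1 - (s ℓ : ℝ) / (Ideal.absNorm (𝔟 ℓ) : ℝ)) : ℝ) : EReal) := by
  -- `absNorm` is 0 for an infinite quotient, which 1 ≤ s_ℓ ≤ N(𝔟_ℓ) excludes.
  have hfin : ∀ l, Finite (𝓞 K ⧸ 𝔟 l) := fun l => Nat.finite_of_card_ne_zero (by
    have h : Nat.card (𝓞 K ⧸ 𝔟 l) = Ideal.absNorm (𝔟 l) := rfl
    have := hs_one l
    have := hs_norm l
    omega)
  let _ : ∀ l, Fintype (𝓞 K ⧸ 𝔟 l) := fun l => Fintype.ofFinite _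
  have hN : ∀ l, Ideal.absNorm (𝔟 l) = Fintype.card (𝓞 K ⧸ 𝔟 l) := fun l =>
    Nat.card_eq_fintype_card (α := 𝓞 K ⧸ 𝔟 l)
  have hclosed : IsClosed (BFree.YGe 𝔟 s : Set (BFree.FullShift (𝓞 K))) := by
    have : (BFree.YGe 𝔟 s : Set (BFree.FullShift (𝓞 K))) =
        ⋂ l, {x | BFree.resCount (𝔟 l) (BFree.supp x) ≤ Ideal.absNorm (𝔟 l) - s l} := by
      ext x
      rw [SetLike.mem_coe, BFree.mem_YGe_iff hs_one, Set.mem_iInter]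
      refine forall_congr' fun l => ?_
      have := hs_norm l
      rw [Set.mem_ofPred_eq]
      omega
    rw [this]
    exact isClosed_iInter fun l => BFree.isClosed_resCount_le _ _
  have h0 : ∀ l, 0 ≤ 1 - (s l : ℝ) / (Ideal.absNorm (𝔟 l) : ℝ) := fun l =>
    sub_nonneg.2 (div_le_one_of_le₀ (by exact_mod_cast hs_norm l) (by positivity))
  have h1 : ∀ l, 1 - (s l : ℝ) / (Ideal.absNorm (𝔟 l) : ℝ) ≤ 1 := fun l =>
    sub_le_self _ (by positivity)
  have hprod := BFree.hasProd_iInf_of_mem_Icc h0 h1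
  refine ⟨hclosed, hprod.multipliable, fun F hF => le_antisymm ?_ ?_⟩
  · refine iSup₂_le fun U hU => iSup_le fun hcov => ?_
    -- For each real c above the product, some partial product is already below c; that many ideals
    -- suffice.
    refine EReal.le_of_forall_lt_iff_le.1 fun c hc => ?_
    obtain ⟨n, hn⟩ := ((hprod.multipliable.hasProd.tendsto_prod_nat).eventually_lt_const
      (EReal.coe_lt_coe_iff.1 hc)).exists
    let π : 𝓞 K →+ (∀ l : Fin n, 𝓞 K ⧸ 𝔟 l) :=
      (RingHom.pi fun l : Fin n => Ideal.Quotient.mk (𝔟 l)).toAddMonoidHom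
    -- Chinese remainder theorem, from pairwise coprimality.
    have hπ : Function.Surjective π := fun q => by
      obtain ⟨r, hr⟩ := Ideal.pi_quotient_surjective (I := fun l : Fin n => 𝔟 l)
        (fun i j hij => hcoprime fun h => hij (Fin.ext h)) q
      exact ⟨r, funext hr⟩
    refine BFree.coverEntropy_le hclosed π hπ
      (∏ l : Fin n, (Fintype.card (𝓞 K ⧸ 𝔟 l) - s l)) (fun y hy => ?_) hF hU hcov ?_
    · refine BFree.exists_finset_quotients 𝔟 n fun l => ?_
      rw [← hN]
      exact (BFree.mem_YGe_iff hs_one).1 hy l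
    -- The ratio m/|Q| is exactly the n-th partial product.
    · refine lt_of_eq_of_lt ?_ hn
      rw [Fintype.card_pi, ← Fin.prod_univ_eq_prod_range
        (fun l => 1 - (s l : ℝ) / (Ideal.absNorm (𝔟 l) : ℝ)) n, Nat.cast_prod, Nat.cast_prod,
        ← Finset.prod_div_distrib]
      refine Finset.prod_congr rfl fun l _ => ?_
      have hpos : (Fintype.card (𝓞 K ⧸ 𝔟 l) : ℝ) ≠ 0 := by exact_mod_cast Fintype.card_ne_zero
      rw [Nat.cast_sub (by rw [← hN]; exact hs_norm l), sub_div, div_self hpos, hN]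
  · refine BFree.le_topEntropy hF fun A => ?_
    obtain ⟨B, hBA, hB, hZ⟩ := BFree.exists_subset_avoiding_classes
      (fun l => Ideal.Quotient.mk (𝔟 l)) (k := s) (fun l => by rw [← hN]; exact hs_norm l)
      (c := ∏' l, (1 - (s l : ℝ) / (Ideal.absNorm (𝔟 l) : ℝ))) (fun n => by
        simp_rw [← hN]
        rw [hprod.tprod_eq]
        refine ciInf_le ⟨0, ?_⟩ (Finset.range n)
        rintro _ ⟨t, rfl⟩
        exact Finset.prod_nonneg fun i _ => h0 i) A
    refine ⟨B, hBA, hB, fun x hx => (BFree.mem_YGe_iff hs_one).2 fun l => ?_⟩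
    obtain ⟨Z, hZs, hZ⟩ := hZ l
    rw [← hZs, hN]
    exact BFree.resCount_add_card_le _ fun a ha => hZ a (hx a ha)
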